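/- Let $n\ge 4$ be an integer that is not a multiple of $3$ greater than $30$. For a finite subset $X$ of the Euclidean plane $\mathbb{R}^2$ let \[ B_X(z)=\sum_{P,Q\in X,\ P\ne Q} d(P,Q)^z\qquad(z\in\mathbb{C}) \] be its discrete Riesz energy function (the sum is over ordered pairs of distinct points), and let $L_X$ be the multiset of the distances $d(P,Q)$ of all unordered pairs $\{P,Q\}$ of distinct points of $X$. Let $\Delta_n\subset\mathbb{R}^2$ be the set of vertices of a regular $n$-gon with side length $1$. Then $\Delta_n$ is determined up to isometry by its discrete Riesz energy function, or equally by its multiset of pairwise distances, among the $n$-point subsets of the plane: for every $X\subset\mathbb{R}^2$ with exactly $n$ points, \[ B_X(z)=B_{\Delta_n}(z)\ \text{ for all } z\in\mathbb{C} \quad\Longleftrightarrow\quad L_X=L_{\Delta_n} \quad\Longleftrightarrow\quad X\text{ is isometric to }\Delta_n . \] -/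

import Mathlib

/-- The discrete Riesz energy function `B_X(z) = ∑_{P ≠ Q} d(P, Q) ^ z` (`z ∈ ℂ`) of a finite
subset `X` of a metric space; the sum is over ordered pairs of distinct points. -/
noncomputable def rieszEnergy {E : Type*} [MetricSpace E] (X : Finset E) (z : ℂ) : ℂ :=
  open Classical in ∑ p ∈ X.offDiag, ((dist p.1 p.2 : ℝ) : ℂ) ^ z

/-- The multiset of pairwise distances of a finite subset `X` of a metric space: each unordered
pair of distinct points of `X` contributes its distance once. -/
noncomputable def distanceMultiset {E : Type*} [MetricSpace E] (X : Finset E) : Multiset ℝ :=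
  open Classical in
  (X.sym2.filter (fun e => ¬ e.IsDiag)).val.map (Sym2.lift ⟨fun P Q => dist P Q, dist_comm⟩)

/-- The `k`-th vertex of the regular `n`-gon of side length `1` centred at the origin; the
circumradius is `1 / (2 sin (π / n))`. -/
noncomputable def regularPolygonVertex (n k : ℕ) : EuclideanSpace ℝ (Fin 2) :=
  (1 / (2 * Real.sin (Real.pi / n))) •
    !₂[Real.cos (2 * Real.pi * k / n), Real.sin (2 * Real.pi * k / n)]

/-- The set of vertices of the regular `n`-gon of side length `1`. -/
noncomputable def regularPolygon (n : ℕ) : Finset (EuclideanSpace ℝ (Fin 2)) :=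
  open Classical in (Finset.range n).image (regularPolygonVertex n)

/-! Identify the plane with ℂ and move the centroid of `X` to 0, giving points f_i; let R be the
circumradius. The values of the energy at z = 2, 4, 6, … suffice. The second moment gives Σ|f_i|² =
nR². The fourth adds the term |Σ f_i²|² ≥ 0, which vanishes for the polygon, so Σ|f_i|⁴ ≤ nR⁴; the
|f_i|² then have variance zero and all points lie on the circle (`normSq_eq_and_exists_pow_eq`).
There, Chebyshev polynomials of the squared distances recover each |Σ f_i^k|², so the power sums
vanish for 0 < k < n. This forces ∏(X - f_i) = X^n - c (`exists_pow_card_eq`): the points are a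
rotated regular polygon. -/

/-! ### Second and fourth moments of the distances -/

open Finset in
/-- The sum of the squared mutual distances of a planar family with centroid at the origin. -/
theorem sum_sum_normSq_sub {ι : Type*} (s : Finset ι) (f : ι → ℂ) (h : ∑ i ∈ s, f i = 0) :
    ∑ i ∈ s, ∑ j ∈ s, Complex.normSq (f i - f j) = 2 * #s * ∑ i ∈ s, Complex.normSq (f i) := by
  have hc : ∑ i ∈ s, ∑ j ∈ s, (f i * (starRingEnd ℂ) (f j)).re = 0 := by
    simp_rw [← Complex.re_sum, ← mul_sum, ← map_sum, h]
    simp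
  simp_rw [Complex.normSq_sub, sum_sub_distrib, sum_add_distrib, ← mul_sum, hc]
  simp only [sum_const, nsmul_eq_mul, ← mul_sum]
  ring

open Finset in
/-- The sum of the fourth powers of the mutual distances of a planar family with centroid at the
origin. -/
theorem sum_sum_normSq_sub_sq {ι : Type*} (s : Finset ι) (f : ι → ℂ) (h : ∑ i ∈ s, f i = 0) :
    ∑ i ∈ s, ∑ j ∈ s, Complex.normSq (f i - f j) ^ 2 =
      2 * #s * ∑ i ∈ s, Complex.normSq (f i) ^ 2 + 4 * (∑ i ∈ s, Complex.normSq (f i)) ^ 2 +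
        2 * Complex.normSq (∑ i ∈ s, f i ^ 2) := by
  -- Square |a|² + |b|² - 2 Re(a b̄), using 2 Re(w)² = |w|² + Re(w²) for w = a b̄. The last two
  -- terms are linear in b or in a, so the centroid condition kills their sums.
  have hterm : ∀ a b : ℂ, Complex.normSq (a - b) ^ 2 =
      Complex.normSq a ^ 2 + Complex.normSq b ^ 2 + 4 * (Complex.normSq a * Complex.normSq b) +
        2 * (a ^ 2 * (starRingEnd ℂ) (b ^ 2)).re -
        4 * (Complex.normSq a * (a * (starRingEnd ℂ) b).re) -
        4 * ((b * (starRingEnd ℂ) a).re * Complex.normSq b) := by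
    intro a b
    simp only [Complex.normSq_apply, Complex.mul_re, Complex.conj_re, Complex.conj_im,
      Complex.sub_re, Complex.sub_im, pow_two, Complex.mul_im, map_mul]
    ring
  have h1 : ∑ i ∈ s, ∑ j ∈ s,
      4 * (Complex.normSq (f i) * (f i * (starRingEnd ℂ) (f j)).re) = 0 := by
    simp_rw [← mul_sum, ← Complex.re_sum, ← mul_sum, ← map_sum, h]
    simp
  have h2 : ∑ i ∈ s, ∑ j ∈ s,
      4 * ((f j * (starRingEnd ℂ) (f i)).re * Complex.normSq (f j)) = 0 := by
    rw [sum_comm, ← h1]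
    simp_rw [mul_comm (Complex.re _)]
  have h3 : ∑ i ∈ s, ∑ j ∈ s, 2 * (f i ^ 2 * (starRingEnd ℂ) (f j ^ 2)).re =
      2 * Complex.normSq (∑ i ∈ s, f i ^ 2) := by
    simp_rw [← mul_sum, ← Complex.re_sum, ← mul_sum, ← map_sum, ← sum_mul, Complex.mul_conj]
    simp
  have h4 : ∑ i ∈ s, ∑ j ∈ s, 4 * (Complex.normSq (f i) * Complex.normSq (f j)) =
      4 * (∑ i ∈ s, Complex.normSq (f i)) ^ 2 := by
    simp_rw [pow_two, sum_mul_sum, ← mul_sum]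
  simp only [hterm, sum_sub_distrib, sum_add_distrib, h1, h2, h3, h4]
  simp only [sum_const, nsmul_eq_mul, ← mul_sum]
  ring

/-- Two families with the same power sums of squared mutual distances have the same sums of
every polynomial in the squared mutual distances. -/
theorem sum_sum_eval_normSq_sub_eq {ι κ : Type*} {s : Finset ι} {t : Finset κ} {f : ι → ℂ}
    {g : κ → ℂ}
    (h : ∀ k : ℕ, ∑ i ∈ s, ∑ j ∈ s, Complex.normSq (f i - f j) ^ k =
      ∑ i ∈ t, ∑ j ∈ t, Complex.normSq (g i - g j) ^ k) (p : Polynomial ℝ) :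
    ∑ i ∈ s, ∑ j ∈ s, p.eval (Complex.normSq (f i - f j)) =
      ∑ i ∈ t, ∑ j ∈ t, p.eval (Complex.normSq (g i - g j)) := by
  induction p using Polynomial.induction_on' with
  | add p q hp hq => simp only [Polynomial.eval_add, Finset.sum_add_distrib, hp, hq]
  | monomial k a => simp only [Polynomial.eval_monomial, ← Finset.mul_sum, h k]

/-! ### Power sums of points on a circle -/

/-- The Chebyshev polynomial of the first kind turns the real part of a complex number of
modulus one into the real part of its power. -/
theorem eval_chebyshevT_re {w : ℂ} (hw : ‖w‖ = 1) (k : ℕ) :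
    (Polynomial.Chebyshev.T ℝ k).eval w.re = (w ^ k).re := by
  have h : w = Complex.exp (w.arg * Complex.I) := by
    simpa [hw] using (Complex.norm_mul_exp_arg_mul_I w).symm
  have h1 : w.re = Real.cos w.arg := by
    conv_lhs => rw [h]
    rw [Complex.exp_ofReal_mul_I_re]
  have h2 : (w ^ k).re = Real.cos (k * w.arg) := by
    conv_lhs => rw [h, ← Complex.exp_nat_mul]
    rw [← mul_assoc]
    exact_mod_cast Complex.exp_ofReal_mul_I_re (k * w.arg)
  rw [h1, h2]
  exact_mod_cast Polynomial.Chebyshev.T_real_cos w.arg k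

/-- For points of a circle centred at the origin, the modulus of a power sum is the sum of a
polynomial in the squared mutual distances. -/
theorem sum_sum_eval_chebyshevT {ι : Type*} (s : Finset ι) (f : ι → ℂ) {R : ℝ} (hR : 0 < R)
    (hf : ∀ i ∈ s, Complex.normSq (f i) = R ^ 2) (k : ℕ) :
    ∑ i ∈ s, ∑ j ∈ s, ((Polynomial.Chebyshev.T ℝ k).comp
        (1 - Polynomial.C (1 / (2 * R ^ 2)) * Polynomial.X)).eval
          (Complex.normSq (f i - f j)) =
      Complex.normSq (∑ i ∈ s, f i ^ k) / (R ^ 2) ^ k := by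
  have hR2 : R ^ 2 ≠ 0 := by positivity
  have key : ∀ i ∈ s, ∀ j ∈ s, ((Polynomial.Chebyshev.T ℝ k).comp
        (1 - Polynomial.C (1 / (2 * R ^ 2)) * Polynomial.X)).eval
          (Complex.normSq (f i - f j)) =
      (f i ^ k * (starRingEnd ℂ) (f j ^ k)).re / (R ^ 2) ^ k := by
    intro i hi j hj
    set w : ℂ := f i * (starRingEnd ℂ) (f j) / ((R ^ 2 : ℝ) : ℂ) with hw
    have hn : ‖w‖ = 1 := by
      have hi' : ‖f i‖ = R := by
        rw [← sq_eq_sq₀ (norm_nonneg _) hR.le, ← Complex.normSq_eq_norm_sq, hf i hi]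
      have hj' : ‖f j‖ = R := by
        rw [← sq_eq_sq₀ (norm_nonneg _) hR.le, ← Complex.normSq_eq_norm_sq, hf j hj]
      rw [hw, norm_div, norm_mul, RCLike.norm_conj, hi', hj', Complex.norm_real,
        Real.norm_of_nonneg (by positivity)]
      field_simp
    -- Law of cosines: `w.re` is the cosine of the central angle between the two points.
    have hre : 1 - 1 / (2 * R ^ 2) * Complex.normSq (f i - f j) = w.re := by
      rw [hw, Complex.div_ofReal_re, Complex.normSq_sub, hf i hi, hf j hj]
      field_simp
      ring
    rw [Polynomial.eval_comp]
    simp only [Polynomial.eval_sub, Polynomial.eval_one, Polynomial.eval_mul,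
      Polynomial.eval_C, Polynomial.eval_X]
    rw [hre, eval_chebyshevT_re hn, hw, div_pow, mul_pow, ← map_pow, ← Complex.ofReal_pow,
      Complex.div_ofReal_re]
  rw [Finset.sum_congr rfl fun i hi => Finset.sum_congr rfl fun j hj => key i hi j hj]
  simp_rw [← Finset.sum_div, ← Complex.re_sum, ← Finset.mul_sum, ← map_sum, ← Finset.sum_mul,
    Complex.mul_conj]
  simp

open Finset in
/-- If the power sums of exponents `1, …, n - 1` of `n` points of a circle centred at the origin
vanish, then these points have the same `n`-th power. -/
theorem exists_pow_card_eq {ι : Type*} (s : Finset ι) (f : ι → ℂ) {R : ℝ} (hR : 0 < R)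
    (hf : ∀ i ∈ s, Complex.normSq (f i) = R ^ 2)
    (hp : ∀ k, 0 < k → k < #s → ∑ i ∈ s, f i ^ k = 0) :
    ∃ c : ℂ, ∀ i ∈ s, f i ^ #s = c := by
  set F : Polynomial ℂ := ∏ i ∈ s, (Polynomial.X - Polynomial.C (f i)) with hF
  have hdeg : F.natDegree = #s := Polynomial.natDegree_finsetProd_X_sub_C_eq_card s f
  have hmonic : F.Monic := Polynomial.monic_prod_of_monic _ _ fun i _ => Polynomial.monic_X_sub_C _
  have hroot : ∀ i ∈ s, F.eval (f i) = 0 := by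
    intro i hi
    rw [hF, Polynomial.eval_prod]
    exact prod_eq_zero hi (by simp)
  have hRC : ((R ^ 2 : ℝ) : ℂ) ≠ 0 := by
    exact_mod_cast (by positivity : R ^ 2 ≠ 0)
  have hconj : ∀ i ∈ s, f i * (starRingEnd ℂ) (f i) = ((R ^ 2 : ℝ) : ℂ) := by
    intro i hi
    rw [Complex.mul_conj, hf i hi]
  -- On the circle f_i f̄_i = R², so the sum reduces to a power sum of exponent |k - j|, possibly
  -- conjugated. As 0 < j < #s, this exponent stays below #s even at k = 0 and k = #s.
  have hcross : ∀ j k, k ≤ #s → 0 < j → j < #s → k ≠ j →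
      ∑ i ∈ s, f i ^ k * (starRingEnd ℂ) (f i) ^ j = 0 := by
    intro j k hk hj0 hjn hkj
    rcases lt_or_gt_of_ne hkj with h | h
    · obtain ⟨m, rfl⟩ := Nat.exists_eq_add_of_lt h
      have : ∀ i ∈ s, f i ^ k * (starRingEnd ℂ) (f i) ^ (k + m + 1) =
          ((R ^ 2 : ℝ) : ℂ) ^ k * (starRingEnd ℂ) (f i ^ (m + 1)) := by
        intro i hi
        rw [← hconj i hi, map_pow]
        ring
      rw [sum_congr rfl this, ← mul_sum, ← map_sum, hp (m + 1) (by omega) (by omega)]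
      simp
    · obtain ⟨m, rfl⟩ := Nat.exists_eq_add_of_lt h
      have : ∀ i ∈ s, f i ^ (j + m + 1) * (starRingEnd ℂ) (f i) ^ j =
          ((R ^ 2 : ℝ) : ℂ) ^ j * f i ^ (m + 1) := by
        intro i hi
        rw [← hconj i hi]
        ring
      rw [sum_congr rfl this, ← mul_sum, hp (m + 1) (by omega) (by omega)]
      simp
  have hcoeff : ∀ j, 0 < j → j < #s → F.coeff j = 0 := by
    intro j hj0 hjn
    -- Fourier extraction: by `hcross`, pairing F(f_i) = 0 with f̄_i^j leaves only #s · R^(2j) times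
    -- the j-th coefficient.
    have h0 : ∑ i ∈ s, F.eval (f i) * (starRingEnd ℂ) (f i) ^ j = 0 :=
      sum_eq_zero fun i hi => by rw [hroot i hi, zero_mul]
    simp_rw [Polynomial.eval_eq_sum_range, hdeg, sum_mul] at h0
    rw [sum_comm, sum_eq_single_of_mem j (by simp; omega)] at h0
    · have : ∀ i ∈ s, F.coeff j * f i ^ j * (starRingEnd ℂ) (f i) ^ j =
          F.coeff j * ((R ^ 2 : ℝ) : ℂ) ^ j := by
        intro i hi
        rw [← hconj i hi]
        ring
      rw [sum_congr rfl this, sum_const, nsmul_eq_mul] at h0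
      have hs : (#s : ℂ) ≠ 0 := by
        exact_mod_cast (by omega : #s ≠ 0)
      simpa [hs, hR.ne'] using h0
    · intro k hk hkj
      simp_rw [mul_assoc, ← mul_sum]
      rw [hcross j k (by simpa [Nat.lt_succ_iff] using hk) hj0 hjn hkj, mul_zero]
  refine ⟨-F.coeff 0, fun i hi => ?_⟩
  have hpos : 0 < #s := card_pos.mpr ⟨i, hi⟩
  have h0 := hroot i hi
  rw [Polynomial.eval_eq_sum_range, hdeg, sum_range_succ, ← hdeg, hmonic.coeff_natDegree, hdeg,
    sum_eq_single_of_mem 0 (by simpa using hpos)] at h0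
  · rw [pow_zero, mul_one, one_mul] at h0
    exact (neg_eq_of_add_eq_zero_right h0).symm
  · intro k hk hk0
    rw [hcoeff k (Nat.pos_of_ne_zero hk0) (by simpa using hk), zero_mul]

open Finset in
/-- A family of `n ≥ 3` points of the complex plane with centroid at the origin and with the same
power sums of squared mutual distances as the `n` vertices `R ζ ^ k` of a regular polygon consists
of points whose modulus is `R` and whose `n`-th powers coincide. -/
theorem normSq_eq_and_exists_pow_eq {ι : Type*} {s : Finset ι} {f : ι → ℂ} {n : ℕ} (hn : 3 ≤ n)
    (hs : #s = n) {R : ℝ} (hR : 0 < R) {ζ : ℂ} (hζ : IsPrimitiveRoot ζ n)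
    (hf : ∑ i ∈ s, f i = 0)
    (h : ∀ k : ℕ, ∑ i ∈ s, ∑ j ∈ s, Complex.normSq (f i - f j) ^ k =
      ∑ i ∈ range n, ∑ j ∈ range n, Complex.normSq (R * ζ ^ i - R * ζ ^ j) ^ k) :
    (∀ i ∈ s, Complex.normSq (f i) = R ^ 2) ∧ ∃ c : ℂ, ∀ i ∈ s, f i ^ n = c := by
  have hnR : (0 : ℝ) < n := by exact_mod_cast (by omega : 0 < n)
  have hζ1 : Complex.normSq ζ = 1 := by
    rw [Complex.normSq_eq_norm_sq, hζ.norm'_eq_one (by omega), one_pow]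
  have hg : ∀ i ∈ range n, Complex.normSq (R * ζ ^ i) = R ^ 2 := by
    intro i _
    rw [map_mul, map_pow, hζ1, Complex.normSq_ofReal, one_pow]
    ring
  have hgp : ∀ k, 0 < k → k < n → ∑ i ∈ range n, ((R : ℂ) * ζ ^ i) ^ k = 0 := by
    intro k hk0 hkn
    have hne : ζ ^ k ≠ 1 := hζ.pow_ne_one_of_pos_of_lt hk0.ne' hkn
    have : ∑ i ∈ range n, (ζ ^ k) ^ i = 0 := by
      rw [geom_sum_eq hne, ← pow_mul, mul_comm, pow_mul, hζ.pow_eq_one, one_pow, sub_self,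
        zero_div]
    simp_rw [mul_pow, ← mul_sum, ← pow_mul, mul_comm _ k, pow_mul, this, mul_zero]
  have hg1 : ∑ i ∈ range n, (R : ℂ) * ζ ^ i = 0 := by
    simpa using hgp 1 one_pos (by omega)
  have hE1 := h 1
  simp only [pow_one] at hE1
  rw [sum_sum_normSq_sub s f hf, sum_sum_normSq_sub _ _ hg1, sum_congr rfl hg, hs] at hE1
  simp only [card_range, sum_const, nsmul_eq_mul] at hE1
  have hS : ∑ i ∈ s, Complex.normSq (f i) = n * R ^ 2 :=
    mul_left_cancel₀ (by positivity) hE1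
  -- The polygon's sum of squares vanishes because 2 < n.
  have hE2 := h 2
  rw [sum_sum_normSq_sub_sq s f hf, sum_sum_normSq_sub_sq _ _ hg1,
    sum_congr (s₁ := range n) rfl fun i hi => congrArg (· ^ 2) (hg i hi), sum_congr rfl hg, hs, hS,
    hgp 2 two_pos (by omega)] at hE2
  simp only [card_range, sum_const, nsmul_eq_mul, map_zero] at hE2
  have hp2 := Complex.normSq_nonneg (∑ i ∈ s, f i ^ 2)
  have hS4 : ∑ i ∈ s, Complex.normSq (f i) ^ 2 ≤ n * R ^ 4 := by
    refine le_of_mul_le_mul_left (a := 2 * (n : ℝ)) ?_ (by positivity)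
    linarith
  have hvar : ∑ i ∈ s, (Complex.normSq (f i) - R ^ 2) ^ 2 ≤ 0 := by
    have : ∑ i ∈ s, (Complex.normSq (f i) - R ^ 2) ^ 2 =
        ∑ i ∈ s, Complex.normSq (f i) ^ 2 - 2 * R ^ 2 * ∑ i ∈ s, Complex.normSq (f i) +
          n * R ^ 4 := by
      rw [mul_sum, ← sum_sub_distrib, ← hs, ← nsmul_eq_mul, ← sum_const, ← sum_add_distrib]
      exact sum_congr rfl fun i _ => by ring
    rw [this, hS]
    linarith
  have hcirc : ∀ i ∈ s, Complex.normSq (f i) = R ^ 2 := by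
    intro i hi
    have := (sum_eq_zero_iff_of_nonneg fun i _ => sq_nonneg (Complex.normSq (f i) - R ^ 2)).mp
      (le_antisymm hvar (sum_nonneg fun i _ => sq_nonneg _)) i hi
    exact sub_eq_zero.mp (pow_eq_zero_iff two_ne_zero |>.mp this)
  refine ⟨hcirc, ?_⟩
  rw [← hs]
  refine exists_pow_card_eq s f hR hcirc fun k hk0 hkn => ?_
  -- Both families lie on the circle of radius R, so the same polynomial in the squared distances
  -- computes the k-th power sum's modulus for each.
  have hT := sum_sum_eval_normSq_sub_eq h ((Polynomial.Chebyshev.T ℝ k).comp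
        (1 - Polynomial.C (1 / (2 * R ^ 2)) * Polynomial.X))
  rw [sum_sum_eval_chebyshevT s f hR hcirc, sum_sum_eval_chebyshevT _ _ hR hg,
    hgp k hk0 (hs ▸ hkn), map_zero, zero_div, div_eq_zero_iff, Complex.normSq_eq_zero] at hT
  exact hT.resolve_right (by positivity)

/-! ### Distance multisets and energies -/

open Finset in
/-- The distances of a finite set, counted once for each ordered pair of distinct points. -/
theorem two_nsmul_distanceMultiset {E : Type*} [MetricSpace E] [DecidableEq E] (X : Finset E) :
    2 • distanceMultiset X = X.offDiag.val.map fun p => dist p.1 p.2 := by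
  classical
  -- An arbitrary linear order selects one ordered pair from each unordered pair.
  let : LinearOrder E := linearOrderOfSTO WellOrderingRel
  have h1 : distanceMultiset X =
      ∑ p ∈ X.offDiag with p.1 < p.2, ({dist p.1 p.2} : Multiset ℝ) := by
    have := sum_sym2_filter_not_isDiag X
      (fun e => ({Sym2.lift ⟨fun P Q => dist P Q, dist_comm⟩ e} : Multiset ℝ))
    simp only [Sym2.lift_mk] at this
    convert this using 1
    rw [distanceMultiset, ← Multiset.sum_map_singleton (Multiset.map _ _), Multiset.map_map,
      Finset.sum]
    congr!
  have h2 : ∑ p ∈ X.offDiag with p.1 < p.2, ({dist p.1 p.2} : Multiset ℝ) =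
      ∑ p ∈ X.offDiag with ¬ p.1 < p.2, ({dist p.1 p.2} : Multiset ℝ) := by
    refine sum_nbij' Prod.swap Prod.swap ?_ ?_ ?_ ?_ ?_
    · simp +contextual [and_comm, le_of_lt, eq_comm]
    · simp +contextual [and_comm, lt_iff_le_and_ne, eq_comm]
    · simp
    · simp
    · simp [dist_comm]
  rw [two_nsmul]
  nth_rewrite 2 [h1]
  rw [h1]
  nth_rewrite 2 [h2]
  rw [sum_filter_add_sum_filter_not, ← Multiset.sum_map_singleton (Multiset.map _ _),
    Multiset.map_map]
  rfl

/-- Isometric finite sets have the same distances of ordered pairs of distinct points. -/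
theorem map_dist_offDiag_eq_of_isometryEquiv {E E' : Type*} [MetricSpace E] [MetricSpace E']
    [DecidableEq E] [DecidableEq E'] {X : Finset E} {Y : Finset E'} (e : X ≃ᵢ Y) :
    (X.offDiag.val.map fun p => dist p.1 p.2) = Y.offDiag.val.map fun p => dist p.1 p.2 := by
  refine Multiset.map_eq_map_of_bij_of_nodup _ _ X.offDiag.nodup Y.offDiag.nodup
    (fun p hp => ((e ⟨p.1, (Finset.mem_offDiag.mp hp).1⟩ : E'),
      (e ⟨p.2, (Finset.mem_offDiag.mp hp).2.1⟩ : E'))) ?_ ?_ ?_ ?_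
  · intro p hp
    have := (Finset.mem_offDiag.mp hp).2.2
    refine Finset.mem_offDiag.mpr ⟨Subtype.coe_prop _, Subtype.coe_prop _, ?_⟩
    simpa [← Subtype.ext_iff] using this
  · intro p hp q hq h
    simpa [← Subtype.ext_iff, Prod.ext_iff] using h
  · intro q hq
    obtain ⟨h1, h2, h3⟩ := Finset.mem_offDiag.mp hq
    refine ⟨(e.symm ⟨q.1, h1⟩, e.symm ⟨q.2, h2⟩), ?_, ?_⟩
    · refine Finset.mem_offDiag.mpr ⟨Subtype.coe_prop _, Subtype.coe_prop _, ?_⟩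
      simpa [← Subtype.ext_iff] using h3
    · simp
  · intro p hp
    exact (e.dist_eq ⟨p.1, _⟩ ⟨p.2, _⟩).symm

/-- The Riesz energy function in terms of the distances of ordered pairs of distinct points. -/
theorem rieszEnergy_eq_sum_map {E : Type*} [MetricSpace E] [DecidableEq E] (X : Finset E) (z : ℂ) :
    rieszEnergy X z =
      ((X.offDiag.val.map fun p => dist p.1 p.2).map fun r : ℝ => (r : ℂ) ^ z).sum := by
  rw [Multiset.map_map, rieszEnergy, Finset.sum]
  congr!

open Finset in
/-- The Riesz energy function at a positive even integer. -/
theorem rieszEnergy_two_mul {E : Type*} [MetricSpace E] (X : Finset E) {k : ℕ} (hk : k ≠ 0) :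
    rieszEnergy X ((2 * k : ℕ) : ℂ) = ((∑ P ∈ X, ∑ Q ∈ X, (dist P Q ^ 2) ^ k : ℝ) : ℂ) := by
  classical
  -- The diagonal contributes nothing only for k ≠ 0, since 0 ^ 0 = 1.
  have h0 : ∑ p ∈ X.diag, (dist p.1 p.2 ^ 2) ^ k = 0 := by
    refine sum_eq_zero fun p hp => ?_
    rw [(mem_diag.mp hp).2, dist_self, zero_pow two_ne_zero, zero_pow hk]
  rw [← sum_product', ← diag_union_offDiag, sum_union (disjoint_diag_offDiag X), h0, zero_add,
    rieszEnergy]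
  rw [Complex.ofReal_sum]
  refine Finset.sum_congr (by congr!) fun p _ => ?_
  rw [Complex.cpow_natCast, pow_mul]
  push_cast
  rfl

/-! ### The regular polygon and the isometry -/

/-- The circumradius of the regular `n`-gon of side length `1` is positive. -/
theorem circumradius_pos {n : ℕ} (hn : 2 ≤ n) : 0 < 1 / (2 * Real.sin (Real.pi / n)) := by
  have hn' : (2 : ℝ) ≤ n := by exact_mod_cast hn
  have : 0 < Real.sin (Real.pi / n) := by
    refine Real.sin_pos_of_pos_of_lt_pi (by positivity) ?_
    rw [div_lt_iff₀ (by positivity)]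
    nlinarith [Real.pi_pos]
  positivity

/-- The vertices of the regular polygon, in the complex plane. -/
theorem repr_symm_regularPolygonVertex (n k : ℕ) :
    Complex.orthonormalBasisOneI.repr.symm (regularPolygonVertex n k) =
      ((1 / (2 * Real.sin (Real.pi / n)) : ℝ) : ℂ) *
        Complex.exp (2 * Real.pi * Complex.I / n) ^ k := by
  rw [LinearIsometryEquiv.symm_apply_eq]
  have h : Complex.exp (2 * Real.pi * Complex.I / n) ^ k =
      Complex.exp ((2 * Real.pi * k / n : ℝ) * Complex.I) := by
    rw [← Complex.exp_nat_mul]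
    congr 1
    push_cast
    ring
  rw [h]
  ext i
  fin_cases i
  · simp [regularPolygonVertex, Complex.orthonormalBasisOneI_repr_apply, Complex.exp_ofReal_mul_I_re,
      -Complex.ofReal_div, -Complex.ofReal_mul, -Complex.ofReal_sin, -one_div]
  · simp [regularPolygonVertex, Complex.orthonormalBasisOneI_repr_apply, Complex.exp_ofReal_mul_I_im,
      -Complex.ofReal_div, -Complex.ofReal_mul, -Complex.ofReal_sin, -one_div]

/-- The vertices of the regular `n`-gon are distinct. -/
theorem injOn_regularPolygonVertex {n : ℕ} (hn : 2 ≤ n) :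
    Set.InjOn (regularPolygonVertex n) (Finset.range n) := by
  intro i hi j hj hij
  have h := congrArg Complex.orthonormalBasisOneI.repr.symm hij
  rw [repr_symm_regularPolygonVertex, repr_symm_regularPolygonVertex] at h
  have hR : ((1 / (2 * Real.sin (Real.pi / n)) : ℝ) : ℂ) ≠ 0 := by
    exact_mod_cast (circumradius_pos hn).ne'
  exact (Complex.isPrimitiveRoot_exp n (by omega)).pow_inj (by simpa using hi) (by simpa using hj)
    (mul_left_cancel₀ hR h)

open Finset in
/-- A set of `n ≥ 3` points of the plane with the same sums of even powers of the mutual distances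
as the regular `n`-gon is isometric to it. -/
theorem nonempty_isometryEquiv_regularPolygon {n : ℕ} (hn : 3 ≤ n)
    {X : Finset (EuclideanSpace ℝ (Fin 2))} (hX : #X = n)
    (h : ∀ k : ℕ, k ≠ 0 → ∑ P ∈ X, ∑ Q ∈ X, (dist P Q ^ 2) ^ k =
      ∑ P ∈ regularPolygon n, ∑ Q ∈ regularPolygon n, (dist P Q ^ 2) ^ k) :
    Nonempty (X ≃ᵢ regularPolygon n) := by
  classical
  have : NeZero n := ⟨by omega⟩
  have hreg : regularPolygon n = (range n).image (regularPolygonVertex n) := by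
    rw [regularPolygon]
  have hinj := injOn_regularPolygonVertex (n := n) (by omega)
  set ψ := Complex.orthonormalBasisOneI.repr
  set R : ℝ := 1 / (2 * Real.sin (Real.pi / n)) with hR
  have hR0 : 0 < R := circumradius_pos (by omega)
  set ζ : ℂ := Complex.exp (2 * Real.pi * Complex.I / n) with hζ
  have hprim : IsPrimitiveRoot ζ n := Complex.isPrimitiveRoot_exp n (by omega)
  have hnC : (n : ℂ) ≠ 0 := by exact_mod_cast (by omega : n ≠ 0)
  set c : ℂ := (∑ P ∈ X, ψ.symm P) / n with hc
  set f : EuclideanSpace ℝ (Fin 2) → ℂ := fun P => ψ.symm P - c with hf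
  have hf0 : ∑ P ∈ X, f P = 0 := by
    rw [hf, sum_sub_distrib, sum_const, hX, nsmul_eq_mul, hc, mul_div_cancel₀ _ hnC, sub_self]
  have hfd : ∀ P Q, Complex.normSq (f P - f Q) = dist P Q ^ 2 := by
    intro P Q
    rw [Complex.normSq_eq_norm_sq, hf, sub_sub_sub_cancel_right, ← dist_eq_norm,
      ψ.symm.dist_map]
  have hgd : ∀ i j, Complex.normSq (R * ζ ^ i - R * ζ ^ j) =
      dist (regularPolygonVertex n i) (regularPolygonVertex n j) ^ 2 := by
    intro i j
    rw [Complex.normSq_eq_norm_sq, ← repr_symm_regularPolygonVertex,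
      ← repr_symm_regularPolygonVertex, ← dist_eq_norm, LinearIsometryEquiv.dist_map]
  obtain ⟨hcirc, d, hd⟩ := normSq_eq_and_exists_pow_eq hn hX hR0 hprim hf0 (by
    intro k
    rcases eq_or_ne k 0 with rfl | hk
    -- Exponent 0 only counts pairs: both sides are n².
    · simp [hX]
    · simp_rw [hfd, hgd, h k hk, hreg]
      rw [sum_image hinj]
      simp_rw [sum_image hinj])
  obtain ⟨P₀, hP₀⟩ : X.Nonempty := card_pos.mp (by omega)
  have hRC : (R : ℂ) ≠ 0 := by exact_mod_cast hR0.ne'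
  have hn0 : ‖f P₀‖ = R := by
    rw [← sq_eq_sq₀ (norm_nonneg _) hR0.le, ← Complex.normSq_eq_norm_sq, hcirc P₀ hP₀]
  have hf00 : f P₀ ≠ 0 := by
    rw [← norm_pos_iff, hn0]
    exact hR0
  have hu : f P₀ / R ∈ Submonoid.unitSphere ℂ := by
    rw [Submonoid.unitSphere, Submonoid.mem_mk, Subsemigroup.mem_mk, mem_sphere_zero_iff_norm,
      norm_div, hn0, Complex.norm_real, Real.norm_of_nonneg hR0.le, div_self hR0.ne']
  -- Rotate the vertex R onto f P₀, then translate the centre to the centroid c of `X`.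
  let Φ : EuclideanSpace ℝ (Fin 2) ≃ᵢ EuclideanSpace ℝ (Fin 2) :=
    (((ψ.symm.trans (rotation ⟨f P₀ / R, hu⟩)).toIsometryEquiv.trans
      (IsometryEquiv.addRight c)).trans ψ.toIsometryEquiv)
  have hsub : X ⊆ (regularPolygon n).image Φ := by
    intro P hP
    -- Equal n-th powers make each quotient an n-th root of unity, which names the vertex sent to P.
    have h1 : (f P / f P₀) ^ n = 1 := by
      rw [div_pow, hd P hP, hd P₀ hP₀, div_self]
      rw [← hd P₀ hP₀]
      exact pow_ne_zero _ hf00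
    obtain ⟨k, hk, hk'⟩ := hprim.eq_pow_of_pow_eq_one h1
    rw [mem_image]
    refine ⟨regularPolygonVertex n k, ?_, ?_⟩
    · rw [hreg]
      exact mem_image_of_mem _ (mem_range.mpr hk)
    · have h2 : f P₀ / R * (R * (f P / f P₀)) = f P := by field_simp
      change ψ (f P₀ / R * ψ.symm (regularPolygonVertex n k) + c) = P
      rw [repr_symm_regularPolygonVertex, ← hζ, ← hR, hk', h2, hf, sub_add_cancel,
        ψ.apply_symm_apply]
  have hXΦ : X = (regularPolygon n).image Φ := by
    refine eq_of_subset_of_card_le hsub (card_image_le.trans ?_)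
    rw [hX, hreg]
    exact card_image_le.trans (card_range n).le
  refine ⟨(IsometryEquiv.mk (Φ.toEquiv.subtypeEquiv fun P => ?_) fun P Q => ?_).symm⟩
  · rw [hXΦ]
    exact (Φ.injective.mem_finset_image).symm
  · exact Φ.isometry P Q

/-- Among `n`-point subsets of the Euclidean plane, the regular `n`-gon of side length `1` is
determined up to isometry by its discrete Riesz energy function, and equally by its multiset of
pairwise distances, provided `n ≥ 4` is not a multiple of `3` greater than `30`. -/
theorem mainTheorem2 (n : ℕ) (hn : 4 ≤ n) (hn3 : ¬ (3 ∣ n ∧ 30 < n))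
    (X : Finset (EuclideanSpace ℝ (Fin 2))) (hX : X.card = n) :
    ((∀ z : ℂ, rieszEnergy X z = rieszEnergy (regularPolygon n) z) ↔
        Nonempty (X ≃ᵢ regularPolygon n)) ∧
      (distanceMultiset X = distanceMultiset (regularPolygon n) ↔
        Nonempty (X ≃ᵢ regularPolygon n)) := by
  classical
  have h1 : (∀ z : ℂ, rieszEnergy X z = rieszEnergy (regularPolygon n) z) →
      Nonempty (X ≃ᵢ regularPolygon n) := by
    intro h
    refine nonempty_isometryEquiv_regularPolygon (by omega) hX fun k hk => ?_
    have := h ((2 * k : ℕ) : ℂ)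
    rw [rieszEnergy_two_mul X hk, rieszEnergy_two_mul _ hk] at this
    exact_mod_cast this
  refine ⟨⟨h1, ?_⟩, fun h => h1 fun z => ?_, ?_⟩
  · rintro ⟨e⟩ z
    rw [rieszEnergy_eq_sum_map, rieszEnergy_eq_sum_map, map_dist_offDiag_eq_of_isometryEquiv e]
  · rw [rieszEnergy_eq_sum_map, rieszEnergy_eq_sum_map, ← two_nsmul_distanceMultiset,
      ← two_nsmul_distanceMultiset, h]
  · rintro ⟨e⟩
    have := map_dist_offDiag_eq_of_isometryEquiv e
    rw [← two_nsmul_distanceMultiset, ← two_nsmul_distanceMultiset] at this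
    -- Ordered pairs count each distance twice; multisets can be halved uniquely.
    exact nsmul_right_injective two_ne_zero this
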